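/- Consider randomized two-party one-way protocols for vertex cover: Alice holds a graph $G_A=(V,E_A)$ and Bob a graph $G_B=(V,E_B)$ on the same vertex set $V$ of $n$ vertices; each party has private random bits and unbounded computational power; Alice sends a single message to Bob, and Bob outputs a set of vertices. The communication of the protocol is the worst-case number of bits in the message. For a graph $G$ let $\mathrm{mvc}(G)$ be the minimum size of a vertex cover of $G$, and let $\lg=\log_2$. Call $(G_A,G_B)$ a bipartite input if $E_A\cap E_B=\emptyset$ and $G_A\cup G_B$ is bipartite. For every constant $\varepsilon>0$ there is a constant $c>0$ such that for every $\delta>0$ there is an $N$ with the following property. Let $n\ge N$, and let $\Pi$ be any such protocol on $n$ vertices that uses at most $n^{1+c/\lg\lg n}$ bits of communication and whose output, on every bipartite input, is always a vertex cover of $G_A\cup G_B$ (in particular, $\Pi$ may be any protocol that outputs a vertex cover on all pairs of graphs). Then there is a bipartite input $(G_A,G_B)$ with $\mathrm{mvc}(G_A\cup G_B)>0$ on which the output $C$ of $\Pi$ satisfies both $$\mathbb{E}\,|C|\ \ge\ \left(\tfrac32-\varepsilon\right)\mathrm{mvc}(G_A\cup G_B)\quad\text{and}\quad \Pr\left[\,|C|\ge\left(\tfrac32-\varepsilon\right)\mathrm{mvc}(G_A\cup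 G_B)\right]\ \ge\ 1-\delta .$$ That is, the approximation ratio of every such protocol is at least $3/2-\varepsilon$, in expectation and with probability $1-o(1)$, already on bipartite graphs. -/

import Mathlib

/-- A randomized two-party one-way protocol on the vertex set `Fin n`, with private randomness and
computationally unbounded parties. Alice sees only her graph and sends one random bit string;
Bob sees only his graph and the message, and outputs a random set of vertices. -/
structure OneWayProtocol (n : ℕ) where
  /-- The distribution of Alice's message, given her graph. -/
  alice : SimpleGraph (Fin n) → PMF (List Bool)
  /-- The distribution of Bob's output, given his graph and the message he receives. -/
  bob : SimpleGraph (Fin n) → List Bool → PMF (Finset (Fin n))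

namespace OneWayProtocol

variable {n : ℕ}

/-- The distribution of the output when Alice holds `GA` and Bob holds `GB`: Bob's randomness is
independent of Alice's. -/
noncomputable def output (P : OneWayProtocol n) (GA GB : SimpleGraph (Fin n)) :
    PMF (Finset (Fin n)) :=
  (P.alice GA).bind (P.bob GB)

/-- The worst-case communication is at most `s` bits: no message that Alice can send, on any graph
and with any outcome of her randomness, is longer than `s`. -/
def CommunicationAtMost (P : OneWayProtocol n) (s : ℝ) : Prop :=
  ∀ GA : SimpleGraph (Fin n), ∀ m ∈ (P.alice GA).support, (m.length : ℝ) ≤ s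

/-- An input on which the lower bound is asked for: the edges of a bipartite graph, distributed
between Alice and Bob so that every edge belongs to exactly one of them. -/
def IsBipartiteInput (GA GB : SimpleGraph (Fin n)) : Prop :=
  Disjoint GA GB ∧ (GA ⊔ GB).IsBipartite

/-- On every bipartite input, the output is always a vertex cover of the whole graph. In particular
this holds for every protocol that outputs vertex covers on arbitrary pairs of graphs. -/
def OutputsVertexCover (P : OneWayProtocol n) : Prop :=
  ∀ GA GB : SimpleGraph (Fin n), IsBipartiteInput GA GB →
    ∀ C ∈ (P.output GA GB).support, (GA ⊔ GB).IsVertexCover (C : Set (Fin n))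

/-- The expected number of vertices in the output. -/
noncomputable def expectedSize (P : OneWayProtocol n) (GA GB : SimpleGraph (Fin n)) : ℝ :=
  ∑ C : Finset (Fin n), (P.output GA GB C).toReal * (C.card : ℝ)

end OneWayProtocol

/-- The size of a minimum vertex cover of a graph on `Fin n`, as a real number (it is finite, being
at most `n`). -/
noncomputable def minVertexCoverSize {n : ℕ} (G : SimpleGraph (Fin n)) : ℝ :=
  (G.vertexCoverNum.toNat : ℝ)

/-- The size is attained: some vertex cover has exactly this many vertices. -/
theorem exists_isVertexCover_card_eq {n : ℕ} (G : SimpleGraph (Fin n)) :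
    ∃ C : Finset (Fin n), G.IsVertexCover (C : Set (Fin n)) ∧
      (C.card : ℝ) = minVertexCoverSize G := by
  classical
  obtain ⟨s, hs, hc⟩ := G.vertexCoverNum_exists
  refine ⟨s.toFinset, by simpa using hc, ?_⟩
  unfold minVertexCoverSize
  rw [← hs, Set.encard_eq_coe_toFinset_card]
  simp

/-- The size is minimal among all vertex covers. -/
theorem minVertexCoverSize_le_card {n : ℕ} (G : SimpleGraph (Fin n)) (C : Finset (Fin n))
    (hC : G.IsVertexCover (C : Set (Fin n))) : minVertexCoverSize G ≤ (C.card : ℝ) := by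
  have h := hC.vertexCoverNum_le
  rw [Set.encard_coe_eq_coe_finsetCard] at h
  unfold minVertexCoverSize
  exact_mod_cast ENat.toNat_le_of_le_natCast h

open Finset

/-! Take induced matchings between two copies of `X`, with `h` elements each, where every matching
covers about half of each copy. Replace each vertex by `L` copies. For each matching edge Alice
keeps only one of its `L` copies, chosen by a function `f`. Bob holds an index `c` and hangs a
pendant edge on every copy of a vertex that the matching `c` misses. The roughly `L * h` copies of
missed vertices cover Bob's edges and, by inducedness, all of Alice's edges outside the matching
`c`; only about `h / 2` edges remain. So the optimum is about `L * h` for large `L`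
(`minVertexCoverSize_sup_le`).

Bob's output must cover the graphs of all `f` compatible with the message. If every value of `f (c,
x)` is still possible, all `L` copies of that edge must be covered. When this holds for most `x`,
about `L * h / 2` further vertices are needed, which gives the ratio `3 / 2`
(`le_card_of_forall_isVertexCover`).

Functions that miss a value at `T` coordinates have density at most `(1 - 1 / L) ^ T`, so too few
short messages exist for every `f` to have a message closing many coordinates. Averaging over `c`
then yields one hard input (`exists_hard_input`).

The `2 ^ w` matchings are translations of a power of `ZMod (2 * w)` by the words of a
Gilbert–Varshamov code (`codeMatchings`). As `w` is of order `lg n / lg lg n`, they carry `n ^ (1 +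
Ω(1 / lg lg n))` edges. -/

/-- A family of induced matchings between two copies of `X`: the matching `c` joins `x` in the
first copy to `shift c x` in the second, for `x` in `part c`; no other matching
has an edge between two vertices that are matched by `c`. -/
structure InducedMatchings (K X : Type*) where
  part : K → Finset X
  shift : K → Equiv.Perm X
  induced : ∀ c c' x z, x ∈ part c → z ∈ part c → x ∈ part c' → shift c' x = shift c z → c' = c

/-! ### Counting: what short messages leave open. -/

/-- A coordinate at which the functions in `F` do not attain every value. -/
def HasMissedValue {I A : Type*} (F : Set (I → A)) (i : I) : Prop :=
  ∃ a, ∀ f ∈ F, f i ≠ a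

open Classical in
-- `F` lies in the product of its coordinate projections, and a projection with a missed value has
-- at most `L - 1` elements.
theorem card_le_of_hasMissedValue {I : Type*} [Fintype I] {L : ℕ} (hL : 0 < L)
    (F : Finset (I → Fin L)) :
    (#F : ℝ) ≤ (L : ℝ) ^ Fintype.card I *
      (1 - 1 / (L : ℝ)) ^ #{i | HasMissedValue (F : Set (I → Fin L)) i} := by
  let m : I → Finset (Fin L) := fun i => univ.filter fun a => ∃ f ∈ F, f i = a
  have hsub : F ⊆ Fintype.piFinset m := by
    intro f hf
    simp only [Fintype.mem_piFinset, m, mem_filter, mem_univ, true_and]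
    exact fun i => ⟨f, hf, rfl⟩
  have hL' : (0 : ℝ) < L := by exact_mod_cast hL
  have hm : ∀ i, (#(m i) : ℝ) ≤
      L * (if HasMissedValue (F : Set (I → Fin L)) i then 1 - 1 / (L : ℝ) else 1) := by
    intro i
    split_ifs with h
    · obtain ⟨a, ha⟩ := h
      have : m i ⊆ univ.erase a := by
        intro b hb
        simp only [m, mem_filter, mem_univ, true_and] at hb
        obtain ⟨f, hf, rfl⟩ := hb
        simpa using ha f hf
      have := card_le_card this
      rw [card_erase_of_mem (mem_univ a), card_univ, Fintype.card_fin] at this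
      have h2 : ((#(m i) : ℕ) : ℝ) ≤ ((L - 1 : ℕ) : ℝ) := by exact_mod_cast this
      rw [Nat.cast_sub hL] at h2
      have : (L : ℝ) * (1 - 1 / L) = L - 1 := by field_simp
      rw [this]; simpa using h2
    · have := card_le_univ (m i)
      rw [Fintype.card_fin] at this
      rw [mul_one]; exact_mod_cast this
  calc (#F : ℝ) ≤ #(Fintype.piFinset m) := by exact_mod_cast card_le_card hsub
    _ = ∏ i, (#(m i) : ℝ) := by rw [Fintype.card_piFinset]; push_cast; rfl
    _ ≤ ∏ i, ((L : ℝ) * (if HasMissedValue (F : Set (I → Fin L)) i then 1 - 1 / (L : ℝ) else 1)) :=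
        prod_le_prod (fun i _ => by positivity) fun i _ => hm i
    _ = _ := by
        rw [prod_mul_distrib, prod_const, card_univ, prod_ite, prod_const, prod_const, one_pow,
          mul_one]

theorem finite_lists_length_le (S : ℕ) :
    ∃ M : Finset (List Bool), (∀ m : List Bool, m.length ≤ S → m ∈ M) ∧ #M ≤ 3 ^ S := by
  have hfin : {m : List Bool | m.length ≤ S}.Finite := List.finite_length_le Bool S
  refine ⟨hfin.toFinset, fun m hm => by simpa using hm, ?_⟩
  -- Padding with `none` up to length `S` encodes a string over three symbols.
  have : #hfin.toFinset ≤ #(univ : Finset (Fin S → Option Bool)) := by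
    refine card_le_card_of_injOn (fun m i => m[(i : ℕ)]?) (fun _ _ => mem_coe.2 (mem_univ _)) ?_
    intro m hm m' hm' h
    have h1 : m.length ≤ S := by simpa using hm
    have h2 : m'.length ≤ S := by simpa using hm'
    apply List.ext_getElem?
    intro i
    by_cases hi : i < S
    · exact congrFun h ⟨i, hi⟩
    · rw [List.getElem?_eq_none (by omega), List.getElem?_eq_none (by omega)]
  simpa using this

open Classical in
/-- If short messages describe functions `I → Fin L`, then for some function every message
it can lead to leaves most coordinates completely open. -/
theorem exists_forall_message_card_hasMissedValue_lt {I : Type*} [Fintype I] {L : ℕ} (hL : 0 < L)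
    (S T : ℕ) (supp : (I → Fin L) → Set (List Bool)) (hS : ∀ f, ∀ m ∈ supp f, m.length ≤ S)
    (hcount : (3 : ℝ) ^ S * (1 - 1 / (L : ℝ)) ^ T < 1) :
    ∃ f, ∀ m ∈ supp f, #{i | HasMissedValue {g | m ∈ supp g} i} < T := by
  by_contra! hcon
  obtain ⟨M, hM, hMc⟩ := finite_lists_length_le S
  let M' := M.filter fun m => T ≤ #{i | HasMissedValue {g | m ∈ supp g} i}
  -- Union bound: if the claim fails, the sets of functions compatible with the bad messages cover
  -- everything, yet their total size is too small.
  have hcov : (univ : Finset (I → Fin L)) ⊆ M'.biUnion fun m => univ.filter fun g => m ∈ supp g := by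
    intro f _
    obtain ⟨m, hm, hT⟩ := hcon f
    simp only [mem_biUnion, mem_filter, mem_univ, true_and, M']
    exact ⟨m, ⟨hM m (hS f m hm), hT⟩, hm⟩
  have hL' : (0 : ℝ) < L := by exact_mod_cast hL
  have hL1 : (1 : ℝ) ≤ L := by exact_mod_cast hL
  have h0 : 0 ≤ 1 - 1 / (L : ℝ) := by
    rw [sub_nonneg, div_le_one hL']; exact hL1
  have h1 : 1 - 1 / (L : ℝ) ≤ 1 := by
    have : 0 ≤ 1 / (L : ℝ) := by positivity
    linarith
  have hb : ∀ m ∈ M', (#(univ.filter fun g : I → Fin L => m ∈ supp g) : ℝ) ≤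
      (L : ℝ) ^ Fintype.card I * (1 - 1 / (L : ℝ)) ^ T := by
    intro m hm
    refine (card_le_of_hasMissedValue hL _).trans ?_
    refine mul_le_mul_of_nonneg_left ?_ (by positivity)
    refine pow_le_pow_of_le_one h0 h1 ?_
    simpa [M'] using (mem_filter.1 hm).2
  have hI : (0 : ℝ) < (L : ℝ) ^ Fintype.card I := by positivity
  have : (L : ℝ) ^ Fintype.card I ≤
      (3 : ℝ) ^ S * ((L : ℝ) ^ Fintype.card I * (1 - 1 / (L : ℝ)) ^ T) := by
    calc (L : ℝ) ^ Fintype.card I = #(univ : Finset (I → Fin L)) := by simp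
      _ ≤ #(M'.biUnion fun m => univ.filter fun g => m ∈ supp g) := by
          exact_mod_cast card_le_card hcov
      _ ≤ ∑ m ∈ M', (#(univ.filter fun g : I → Fin L => m ∈ supp g) : ℝ) := by
          exact_mod_cast card_biUnion_le
      _ ≤ ∑ m ∈ M', ((L : ℝ) ^ Fintype.card I * (1 - 1 / (L : ℝ)) ^ T) := sum_le_sum hb
      _ = #M' * ((L : ℝ) ^ Fintype.card I * (1 - 1 / (L : ℝ)) ^ T) := by
          rw [sum_const, nsmul_eq_mul]
      _ ≤ _ := by
          refine mul_le_mul_of_nonneg_right ?_ (by positivity)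
          exact_mod_cast (card_le_card (filter_subset _ _)).trans hMc
  nlinarith

/-! ### The two graphs and their vertex covers. -/

namespace InducedMatchings

variable {K X : Type*} (D : InducedMatchings K X) {L : ℕ}

/-- A vertex is given by its side, by whether it is pendant, and by a vertex of the matchings. -/
abbrev Vertex (X : Type*) (L : ℕ) := Bool × Bool × X × Fin L

/-- Alice keeps one of the `L` copies of each matching edge. -/
def aliceRel (f : K × X → Fin L) (u v : Vertex X L) : Prop :=
  ∃ c, ∃ x ∈ D.part c, u = (false, false, x, f (c, x)) ∧ v = (true, false, D.shift c x, f (c, x))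

/-- Bob attaches a pendant edge to each vertex that is not matched by the matching `c`. -/
def bobRel (c : K) (u v : Vertex X L) : Prop :=
  ∃ x l, x ∉ D.part c ∧ ((u = (false, false, x, l) ∧ v = (false, true, x, l)) ∨
    (u = (true, false, D.shift c x, l) ∧ v = (true, true, D.shift c x, l)))

variable {n : ℕ} (e : Vertex X L ↪ Fin n)

/-- Alice's graph. -/
def aliceGraph (f : K × X → Fin L) : SimpleGraph (Fin n) :=
  (SimpleGraph.fromRel (D.aliceRel f)).map e

/-- Bob's graph. -/
def bobGraph (c : K) : SimpleGraph (Fin n) :=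
  (SimpleGraph.fromRel (D.bobRel c)).map e

theorem adj_of_aliceRel {f : K × X → Fin L} {u v : Vertex X L} (h : D.aliceRel f u v) :
    (D.aliceGraph e f).Adj (e u) (e v) := by
  rw [aliceGraph, SimpleGraph.map_adj_apply, SimpleGraph.fromRel_adj]
  refine ⟨?_, Or.inl h⟩
  obtain ⟨c, x, -, rfl, rfl⟩ := h
  simp

theorem adj_of_bobRel {c : K} {u v : Vertex X L} (h : D.bobRel c u v) :
    (D.bobGraph e c).Adj (e u) (e v) := by
  rw [bobGraph, SimpleGraph.map_adj_apply, SimpleGraph.fromRel_adj]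
  refine ⟨?_, Or.inl h⟩
  obtain ⟨x, l, -, ⟨rfl, rfl⟩ | ⟨rfl, rfl⟩⟩ := h <;> simp

theorem sup_adj {f : K × X → Fin L} {c : K} {a b : Fin n}
    (h : (D.aliceGraph e f ⊔ D.bobGraph e c).Adj a b) :
    ∃ u v, e u = a ∧ e v = b ∧
      ((D.aliceRel f u v ∨ D.aliceRel f v u) ∨ (D.bobRel c u v ∨ D.bobRel c v u)) := by
  rw [SimpleGraph.sup_adj, aliceGraph, bobGraph, SimpleGraph.map_adj, SimpleGraph.map_adj] at h
  rcases h with ⟨u, v, h, hu, hv⟩ | ⟨u, v, h, hu, hv⟩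
  · exact ⟨u, v, hu, hv, Or.inl h.2⟩
  · exact ⟨u, v, hu, hv, Or.inr h.2⟩

theorem isBipartiteInput (f : K × X → Fin L) (c : K) :
    OneWayProtocol.IsBipartiteInput (D.aliceGraph e f) (D.bobGraph e c) := by
  constructor
  · rw [SimpleGraph.disjoint_left]
    rintro a b ha hb
    rw [aliceGraph, SimpleGraph.map_adj] at ha
    obtain ⟨u, v, ha, rfl, rfl⟩ := ha
    rw [bobGraph, SimpleGraph.map_adj_apply] at hb
    obtain ⟨-, ⟨c', x, -, rfl, rfl⟩ | ⟨c', x, -, rfl, rfl⟩⟩ := ha <;>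
    obtain ⟨-, ⟨y, l, -, h | h⟩ | ⟨y, l, -, h | h⟩⟩ := hb <;> simp at h
  -- Alice's edges flip only the side and Bob's only the pendant bit, so the xor is a proper
  -- colouring. Vertices outside the range of `e` are isolated, and their colour is immaterial.
  · refine ⟨SimpleGraph.Coloring.mk
      (Function.extend e (fun v => if xor v.1 v.2.1 then (1 : Fin 2) else 0) fun _ => 0) ?_⟩
    intro a b h
    obtain ⟨u, v, rfl, rfl, h'⟩ := D.sup_adj e h
    rw [e.injective.extend_apply, e.injective.extend_apply]
    rcases h' with (⟨c', x, -, rfl, rfl⟩ | ⟨c', x, -, rfl, rfl⟩) |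
      (⟨y, l, -, ⟨rfl, rfl⟩ | ⟨rfl, rfl⟩⟩ | ⟨y, l, -, ⟨rfl, rfl⟩ | ⟨rfl, rfl⟩⟩) <;> simp

variable [Fintype X]

open Classical in
-- The cover consists of all copies of the vertices missed by the matching `c`, on both sides, and
-- one endpoint of each edge of Alice in that matching. By inducedness every other edge of Alice has
-- an endpoint missed by `c`.
theorem minVertexCoverSize_sup_le (f : K × X → Fin L) (c : K) :
    minVertexCoverSize (D.aliceGraph e f ⊔ D.bobGraph e c) ≤
      2 * L * ((Fintype.card X : ℝ) - #(D.part c)) + #(D.part c) := by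
  let A : Finset (Vertex X L) := ((D.part c)ᶜ ×ˢ univ).image fun p => (false, false, p.1, p.2)
  let B : Finset (Vertex X L) :=
    ((D.part c)ᶜ ×ˢ univ).image fun p => (true, false, D.shift c p.1, p.2)
  let E : Finset (Vertex X L) := (D.part c).image fun x => (false, false, x, f (c, x))
  have hcov : (D.aliceGraph e f ⊔ D.bobGraph e c).IsVertexCover
      (((A ∪ B ∪ E).map e : Finset (Fin n)) : Set (Fin n)) := by
    intro a b h
    obtain ⟨u, v, rfl, rfl, h'⟩ := D.sup_adj e h
    simp only [coe_map, Function.Embedding.apply_eq_iff_eq, Set.mem_image, SetLike.mem_coe,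
      exists_eq_right]
    have hA : ∀ x l, x ∉ D.part c → ((false, false, x, l) : Vertex X L) ∈ A ∪ B ∪ E := by
      intro x l hx
      simp only [mem_union, A, mem_image, mem_product, mem_compl, mem_univ]
      exact Or.inl (Or.inl ⟨(x, l), ⟨hx, trivial⟩, rfl⟩)
    have hB : ∀ x l, x ∉ D.part c → ((true, false, D.shift c x, l) : Vertex X L) ∈ A ∪ B ∪ E := by
      intro x l hx
      simp only [mem_union, B, mem_image, mem_product, mem_compl, mem_univ]
      exact Or.inl (Or.inr ⟨(x, l), ⟨hx, trivial⟩, rfl⟩)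
    have key : ∀ u v, D.aliceRel f u v ∨ D.bobRel c u v → u ∈ A ∪ B ∪ E ∨ v ∈ A ∪ B ∪ E := by
      rintro u v (⟨c', x, hx, rfl, rfl⟩ | ⟨x, l, hx, ⟨rfl, rfl⟩ | ⟨rfl, rfl⟩⟩)
      · by_cases h1 : x ∈ D.part c
        · obtain ⟨z, hz⟩ := (D.shift c).surjective (D.shift c' x)
          by_cases h2 : z ∈ D.part c
          · obtain rfl := D.induced c c' x z h1 h2 hx hz.symm
            left
            exact mem_union_right _ (mem_image_of_mem _ h1)
          · right; rw [← hz]; exact hB _ _ h2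
        · exact Or.inl (hA _ _ h1)
      · exact Or.inl (hA _ _ hx)
      · exact Or.inl (hB _ _ hx)
    rcases h' with (h | h) | (h | h)
    · exact key _ _ (Or.inl h)
    · exact (key _ _ (Or.inl h)).symm
    · exact key _ _ (Or.inr h)
    · exact (key _ _ (Or.inr h)).symm
  refine (minVertexCoverSize_le_card _ _ hcov).trans ?_
  rw [card_map]
  have h1 : #(A ∪ B ∪ E) ≤ #A + #B + #E :=
    (card_union_le _ _).trans (Nat.add_le_add_right (card_union_le _ _) _)
  have hA : #A ≤ #(D.part c)ᶜ * L := by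
    refine card_image_le.trans ?_
    rw [card_product, card_univ, Fintype.card_fin]
  have hB : #B ≤ #(D.part c)ᶜ * L := by
    refine card_image_le.trans ?_
    rw [card_product, card_univ, Fintype.card_fin]
  have hE : #E ≤ #(D.part c) := card_image_le
  have h2 : ((#(A ∪ B ∪ E) : ℕ) : ℝ) ≤ ((2 * L * #(D.part c)ᶜ + #(D.part c) : ℕ) : ℝ) := by
    have : #(A ∪ B ∪ E) ≤ 2 * L * #(D.part c)ᶜ + #(D.part c) := by nlinarith
    exact_mod_cast this
  rw [card_compl] at h2
  push_cast [Nat.cast_sub (card_le_univ (D.part c))] at h2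
  exact h2

open Classical in
/-- A set that covers the union of all graphs in `F` and of Bob's graph is large. -/
theorem le_card_of_forall_isVertexCover (F : Set (K × X → Fin L)) (hF : F.Nonempty) (c : K)
    (C : Finset (Fin n))
    (hC : ∀ f ∈ F, (D.aliceGraph e f ⊔ D.bobGraph e c).IsVertexCover (C : Set (Fin n))) :
    (L : ℝ) * (2 * Fintype.card X - #(D.part c)) ≤
      #C + L * (#{x | HasMissedValue F (c, x)} : ℝ) := by
  have hcovB : ∀ u v, D.bobRel c u v → e u ∈ C ∨ e v ∈ C := by
    intro u v h
    obtain ⟨f, hf⟩ := hF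
    have : (D.aliceGraph e f ⊔ D.bobGraph e c).Adj (e u) (e v) := Or.inr (D.adj_of_bobRel e h)
    simpa using hC f hf this
  have hcovA : ∀ f ∈ F, ∀ u v, D.aliceRel f u v → e u ∈ C ∨ e v ∈ C := by
    intro f hf u v h
    have : (D.aliceGraph e f ⊔ D.bobGraph e c).Adj (e u) (e v) := Or.inl (D.adj_of_aliceRel e h)
    simpa using hC f hf this
  let C' : Finset (Vertex X L) := C.preimage e e.injective.injOn
  have hC' : #C' ≤ #C := card_le_card_of_injOn e (fun u hu => by simpa [C'] using hu)
    e.injective.injOn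
  -- Both ends of each copy of an edge of the matching `c`, and both ends of each pendant edge, get
  -- the same label, while distinct such edges get distinct labels. The labels met by the cover thus
  -- bound its size from below.
  let label : Vertex X L → (X × Fin L) ⊕ (X × Fin L) := fun v =>
    if v.1 then
      if v.2.1 ∨ (D.shift c).symm v.2.2.1 ∉ D.part c then
        Sum.inr ((D.shift c).symm v.2.2.1, v.2.2.2)
      else Sum.inl ((D.shift c).symm v.2.2.1, v.2.2.2)
    else Sum.inl v.2.2
  let M : Finset X := univ.filter fun x => HasMissedValue F (c, x)
  have hsub : ((Mᶜ ×ˢ univ).disjSum ((D.part c)ᶜ ×ˢ univ) :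
      Finset ((X × Fin L) ⊕ (X × Fin L))) ⊆ C'.image label := by
    intro p hp
    rw [mem_image]
    rw [mem_disjSum] at hp
    rcases hp with ⟨⟨x, l⟩, hx, rfl⟩ | ⟨⟨x, l⟩, hx, rfl⟩
    · by_cases h : x ∈ D.part c
      · have hx' : ¬ HasMissedValue F (c, x) := by simpa [M] using hx
        unfold HasMissedValue at hx'
        push Not at hx'
        obtain ⟨f, hf, rfl⟩ := hx' l
        rcases hcovA f hf _ _ ⟨c, x, h, rfl, rfl⟩ with h' | h'
        · exact ⟨_, by simpa [C'] using h', by simp [label]⟩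
        · exact ⟨_, by simpa [C'] using h', by simp [label, h]⟩
      · rcases hcovB _ _ ⟨x, l, h, Or.inl ⟨rfl, rfl⟩⟩ with h' | h'
        · exact ⟨_, by simpa [C'] using h', by simp [label]⟩
        · exact ⟨_, by simpa [C'] using h', by simp [label]⟩
    · have h : x ∉ D.part c := by simpa using hx
      rcases hcovB _ _ ⟨x, l, h, Or.inr ⟨rfl, rfl⟩⟩ with h' | h'
      · exact ⟨_, by simpa [C'] using h', by simp [label, h]⟩
      · exact ⟨_, by simpa [C'] using h', by simp [label]⟩
  have hcard := (card_le_card hsub).trans (card_image_le.trans hC')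
  rw [card_disjSum, card_product, card_product, card_compl, card_compl, card_univ,
    Fintype.card_fin] at hcard
  have h2 : ((((Fintype.card X - #M) * L + (Fintype.card X - #(D.part c)) * L : ℕ)) : ℝ) ≤ #C := by
    exact_mod_cast hcard
  push_cast [Nat.cast_sub (card_le_univ (D.part c)), Nat.cast_sub (card_le_univ M)] at h2
  have : (#{x | HasMissedValue F (c, x)} : ℝ) = #M := rfl
  rw [this]
  linarith

end InducedMatchings

/-! ### From short messages to a hard input. -/

open Classical in
/-- If each outcome lies in few of the sets `B c`, then one of these sets is unlikely. -/
theorem PMF.exists_toOuterMeasure_le {α K : Type*} [Fintype K] [Nonempty K] (p : PMF α)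
    (B : K → Set α) (δ : ℝ)
    (hB : ∀ m ∈ p.support, (#{c | m ∈ B c} : ℝ) ≤ δ * Fintype.card K) :
    ∃ c, p.toOuterMeasure (B c) ≤ ENNReal.ofReal δ := by
  by_contra! hcon
  -- The sum of the probabilities is the expected number of sets `B c` containing the outcome.
  have hsum : ∑ c, p.toOuterMeasure (B c) = ∑' m, p m * (#{c | m ∈ B c} : ENNReal) := by
    simp_rw [PMF.toOuterMeasure_apply]
    rw [← Summable.tsum_finsetSum fun _ _ => ENNReal.summable]
    refine tsum_congr fun m => ?_
    simp_rw [Set.indicator_apply]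
    rw [← sum_filter, sum_const, nsmul_eq_mul, mul_comm]
  have hle : ∑' m, p m * (#{c | m ∈ B c} : ENNReal) ≤ ENNReal.ofReal δ * Fintype.card K := by
    calc ∑' m, p m * (#{c | m ∈ B c} : ENNReal)
        ≤ ∑' m, p m * (ENNReal.ofReal δ * Fintype.card K) := by
          refine ENNReal.tsum_le_tsum fun m => ?_
          by_cases hm : m ∈ p.support
          · gcongr
            have h := ENNReal.ofReal_le_ofReal (hB m hm)
            rwa [ENNReal.ofReal_natCast, ENNReal.ofReal_mul' (by positivity),
              ENNReal.ofReal_natCast] at h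
          · rw [PMF.mem_support_iff, not_not] at hm
            simp [hm]
      _ = _ := by rw [ENNReal.tsum_mul_right, p.tsum_coe, one_mul]
  have hlt : ENNReal.ofReal δ * Fintype.card K < ∑ c, p.toOuterMeasure (B c) := by
    calc ENNReal.ofReal δ * Fintype.card K = ∑ _c : K, ENNReal.ofReal δ := by
          rw [sum_const, nsmul_eq_mul, mul_comm, card_univ]
      _ < _ := ENNReal.sum_lt_sum_of_nonempty univ_nonempty fun c _ => hcon c
  exact absurd (hsum ▸ hlt) (not_lt.2 hle)

open Classical in
-- For the function `f` fixed by the counting argument, each possible message closes fewer than `T`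
-- coordinates in total. By Markov's inequality at most a fraction `δ` of the matchings have more
-- than `b` closed coordinates, so some `c` is bad for the random message with probability at most
-- `δ`.
theorem InducedMatchings.exists_hard_input {K X : Type*} [Fintype K] [Nonempty K] [Fintype X]
    (D : InducedMatchings K X) {L n : ℕ} (hL : 0 < L) (e : Vertex X L ↪ Fin n)
    (P : OneWayProtocol n) (S T : ℕ) (hS : ∀ G, ∀ m ∈ (P.alice G).support, m.length ≤ S)
    (hP : P.OutputsVertexCover) (hcount : (3 : ℝ) ^ S * (1 - 1 / (L : ℝ)) ^ T < 1)
    (δ b : ℝ) (hb : 0 < b) (hT : (T : ℝ) ≤ δ * Fintype.card K * b) :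
    ∃ f c, ENNReal.ofReal (1 - δ) ≤
      (P.output (D.aliceGraph e f) (D.bobGraph e c)).toOuterMeasure
        {C | (L : ℝ) * (2 * Fintype.card X - #(D.part c)) ≤ #C + L * b} := by
  obtain ⟨f, hf⟩ := exists_forall_message_card_hasMissedValue_lt (I := K × X) hL S T
    (fun f => (P.alice (D.aliceGraph e f)).support) (fun f m hm => hS _ m hm) hcount
  let miss : List Bool → K → ℕ := fun m c =>
    #{x | HasMissedValue {g | m ∈ (P.alice (D.aliceGraph e g)).support} (c, x)}
  obtain ⟨c, hc⟩ := (P.alice (D.aliceGraph e f)).exists_toOuterMeasure_le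
    (fun c : K => {m | b < miss m c}) δ (by
      intro m hm
      have h1 : ∑ c, miss m c < T := by
        refine lt_of_eq_of_lt ?_ (hf m hm)
        simp only [miss, card_filter]
        rw [Fintype.sum_prod_type]
      have h2 : (#{c | b < miss m c} : ℝ) * b ≤ ∑ c, (miss m c : ℝ) := by
        calc (#{c | b < miss m c} : ℝ) * b = ∑ c with b < miss m c, b := by
              rw [sum_const, nsmul_eq_mul]
          _ ≤ ∑ c with b < miss m c, (miss m c : ℝ) :=
              sum_le_sum fun c hc => (mem_filter.1 hc).2.le
          _ ≤ _ := sum_le_sum_of_subset_of_nonneg (filter_subset _ _) fun _ _ _ => by positivity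
      have h3 : (∑ c, (miss m c : ℝ)) ≤ T := by exact_mod_cast h1.le
      exact le_of_mul_le_mul_right ((h2.trans h3).trans hT) hb)
  refine ⟨f, c, ?_⟩
  set p := P.alice (D.aliceGraph e f) with hp
  set E : Set (Finset (Fin n)) :=
    {C | (L : ℝ) * (2 * Fintype.card X - #(D.part c)) ≤ #C + L * b} with hE
  have hgood : p.toOuterMeasure {m | b < miss m c}ᶜ ≤
      (P.output (D.aliceGraph e f) (D.bobGraph e c)).toOuterMeasure E := by
    rw [OneWayProtocol.output, PMF.toOuterMeasure_bind_apply, PMF.toOuterMeasure_apply]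
    refine ENNReal.tsum_le_tsum fun m => ?_
    by_cases hm : m ∈ p.support
    · by_cases hmc : b < miss m c
      · rw [Set.indicator_of_notMem (by simpa using hmc)]; exact zero_le
      · have : (P.bob (D.bobGraph e c) m).toOuterMeasure E = 1 := by
          rw [PMF.toOuterMeasure_apply_eq_one_iff]
          intro C hC
          -- Bob sees only `c` and `m`: an output `C` possible here is also possible on every `g`
          -- that can produce `m`, so `C` covers all those inputs.
          have h := D.le_card_of_forall_isVertexCover e
            {g | m ∈ (P.alice (D.aliceGraph e g)).support} ⟨f, hm⟩ c C (fun g hg =>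
              hP _ _ (D.isBipartiteInput e g c) C
                ((PMF.mem_support_bind_iff _ _ _).2 ⟨m, hg, hC⟩))
          refine h.trans ?_
          have : (miss m c : ℝ) ≤ b := not_lt.1 hmc
          have : (L : ℝ) * miss m c ≤ L * b := by gcongr
          linarith
        rw [this, mul_one]
        exact Set.indicator_le_self _ _ _
    · rw [PMF.mem_support_iff, not_not] at hm
      rw [Set.indicator_apply, hm]; simp
  refine le_trans ?_ hgood
  have h1 : (1 : ENNReal) ≤ p.toOuterMeasure {m | b < miss m c} +
      p.toOuterMeasure {m | b < miss m c}ᶜ := by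
    rw [← (p.toOuterMeasure_apply_eq_one_iff Set.univ).2 (Set.subset_univ _),
      ← Set.union_compl_self {m | b < (miss m c : ℝ)}]
    exact MeasureTheory.measure_union_le _ _
  have hδ : 0 ≤ δ := by
    by_contra! h
    have hK : (0 : ℝ) < Fintype.card K := by exact_mod_cast Fintype.card_pos
    have : δ * Fintype.card K * b < 0 := mul_neg_of_neg_of_pos (mul_neg_of_neg_of_pos h hK) hb
    have : (0 : ℝ) ≤ T := by positivity
    linarith
  rw [ENNReal.ofReal_sub _ hδ, ENNReal.ofReal_one]
  exact tsub_le_iff_left.2 (h1.trans (add_le_add_left hc _))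

/-! ### A code with small pairwise agreement. -/

/-- The number of positions at which two words agree. -/
def agreement {w q : ℕ} (c c' : Fin w → Fin q) : ℕ := #{j | c j = c' j}

/-- Union bound over the at most `2 ^ w` sets of `t + 1` positions of agreement. The alphabet size
`4 ^ a` makes `t + 1` fixed letters cost a factor of at least `4 ^ w`, which pays for both powers `2
^ w`. -/
theorem card_lt_agreement_le {w a t : ℕ} (ha : w ≤ a * (t + 1)) (c : Fin w → Fin (4 ^ a)) :
    2 ^ w * #{c' : Fin w → Fin (4 ^ a) | t < agreement c c'} ≤ (4 ^ a) ^ w := by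
  by_cases htw : t + 1 ≤ w
  · have hsub : ({c' | t < agreement c c'} : Finset (Fin w → Fin (4 ^ a))) ⊆
        (powersetCard (t + 1) univ).biUnion fun J =>
          Fintype.piFinset fun j => if j ∈ J then {c j} else univ := by
      intro c' hc'
      obtain ⟨J, hJ, hJc⟩ := exists_subset_card_eq (Nat.succ_le_of_lt (mem_filter.1 hc').2)
      rw [mem_biUnion]
      refine ⟨J, mem_powersetCard.2 ⟨subset_univ _, hJc⟩, Fintype.mem_piFinset.2 fun j => ?_⟩
      split_ifs with hj
      · exact mem_singleton.2 ((mem_filter.1 (hJ hj)).2).symm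
      · exact mem_univ _
    have hcard : #{c' : Fin w → Fin (4 ^ a) | t < agreement c c'} ≤
        2 ^ w * (4 ^ a) ^ (w - (t + 1)) := by
      refine (card_le_card hsub).trans ((card_biUnion_le_card_mul _ _ ((4 ^ a) ^ (w - (t + 1)))
        fun J hJ => ?_).trans ?_)
      · rw [Fintype.card_piFinset, prod_congr rfl (g := fun j => if j ∈ J then 1 else 4 ^ a)
          (fun j _ => by split_ifs <;> simp), prod_ite, prod_const_one, one_mul, prod_const]
        refine le_of_eq ?_
        congr 1
        rw [filter_not, filter_mem_eq_inter, univ_inter, card_sdiff_of_subset (subset_univ _),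
          (mem_powersetCard.1 hJ).2, card_univ, Fintype.card_fin]
      · refine Nat.mul_le_mul_right _ ?_
        rw [card_powersetCard, card_univ, Fintype.card_fin]
        exact Nat.choose_le_two_pow _ _
    calc 2 ^ w * #{c' : Fin w → Fin (4 ^ a) | t < agreement c c'}
        ≤ 2 ^ w * (2 ^ w * (4 ^ a) ^ (w - (t + 1))) := Nat.mul_le_mul_left _ hcard
      _ = 4 ^ w * (4 ^ a) ^ (w - (t + 1)) := by
          rw [← mul_assoc, ← mul_pow]; norm_num
      _ ≤ (4 ^ a) ^ (t + 1) * (4 ^ a) ^ (w - (t + 1)) := by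
          refine Nat.mul_le_mul_right _ ?_
          rw [← pow_mul]
          exact Nat.pow_le_pow_right (by norm_num) ha
      _ = (4 ^ a) ^ w := by rw [← pow_add]; congr 1; omega
  · have : #{c' : Fin w → Fin (4 ^ a) | t < agreement c c'} = 0 := by
      rw [card_eq_zero, filter_eq_empty_iff]
      intro c' _ h
      have : agreement c c' ≤ w := by
        simpa [agreement] using card_le_univ (univ.filter fun j => c j = c' j)
      omega
    rw [this, mul_zero]; exact Nat.zero_le _

/-- Gilbert–Varshamov. -/
theorem exists_code {w a t : ℕ} (ha : w ≤ a * (t + 1)) (ht : t < w) :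
    ∃ Q : Finset (Fin w → Fin (4 ^ a)), 2 ^ w ≤ #Q ∧
      ∀ c ∈ Q, ∀ c' ∈ Q, c ≠ c' → agreement c c' ≤ t := by
  classical
  let good : Finset (Finset (Fin w → Fin (4 ^ a))) := univ.filter fun Q =>
    ∀ c ∈ Q, ∀ c' ∈ Q, c ≠ c' → agreement c c' ≤ t
  obtain ⟨Q, hQ, hmax⟩ := good.exists_max_image card ⟨∅, by simp [good]⟩
  have hQ' := (mem_filter.1 hQ).2
  refine ⟨Q, ?_, hQ'⟩
  have hsymm : ∀ c c' : Fin w → Fin (4 ^ a), agreement c c' = agreement c' c := fun c c' => by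
    simp only [agreement, eq_comm]
  have hcov : (univ : Finset (Fin w → Fin (4 ^ a))) ⊆
      Q.biUnion fun c => {c' | t < agreement c c'} := by
    intro d _
    by_contra hd
    simp only [mem_biUnion, mem_filter, mem_univ, true_and, not_exists, not_and, not_lt] at hd
    -- A word agrees with itself in `w > t` positions.
    have hdQ : d ∉ Q := by
      intro h
      have := hd d h
      simp only [agreement, filter_true, card_univ, Fintype.card_fin] at this
      omega
    have := hmax (insert d Q) (by
      simp only [good, mem_filter, mem_univ, true_and, mem_insert]
      rintro c (rfl | hc) c' (rfl | hc') hne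
      · exact absurd rfl hne
      · rw [hsymm]; exact hd c' hc'
      · exact hd c hc
      · exact hQ' c hc c' hc' hne)
    rw [card_insert_of_notMem hdQ] at this
    omega
  have h1 := (card_le_card hcov).trans card_biUnion_le
  have h2 : 2 ^ w * (4 ^ a) ^ w ≤ #Q * (4 ^ a) ^ w := by
    calc 2 ^ w * (4 ^ a) ^ w = 2 ^ w * #(univ : Finset (Fin w → Fin (4 ^ a))) := by simp
      _ ≤ ∑ c ∈ Q, 2 ^ w * #{c' : Fin w → Fin (4 ^ a) | t < agreement c c'} := by
          rw [← mul_sum]; exact Nat.mul_le_mul_left _ h1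
      _ ≤ ∑ _c ∈ Q, (4 ^ a) ^ w := sum_le_sum fun c _ => card_lt_agreement_le ha c
      _ = _ := by rw [sum_const, smul_eq_mul]
  exact le_of_mul_le_mul_right h2 (by positivity)

/-! ### Induced matchings from the code. -/

/-- The sum of the coordinates of a vector that lie on the graph of a word. -/
def wordSum {w q D : ℕ} (c : Fin w → Fin q) : (Fin w × Fin q → ZMod D) →+ ZMod D where
  toFun x := ∑ j, x (j, c j)
  map_zero' := by simp
  map_add' x y := by simp [sum_add_distrib]

/-- The indicator vector of the graph of a word. -/
def wordVec {w q D : ℕ} (c : Fin w → Fin q) : Fin w × Fin q → ZMod D :=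
  fun p => if c p.1 = p.2 then 1 else 0

theorem wordSum_wordVec {w q D : ℕ} (c c' : Fin w → Fin q) :
    wordSum c (wordVec c' : Fin w × Fin q → ZMod D) = agreement c' c := by
  simp [wordSum, wordVec, agreement]

theorem agreement_self {w q : ℕ} (c : Fin w → Fin q) : agreement c c = w := by
  simp [agreement]

theorem wordSum_surjective {w q D : ℕ} (hw : 0 < w) (c : Fin w → Fin q) :
    Function.Surjective (wordSum (D := D) c) := by
  intro z
  refine ⟨Pi.single (⟨0, hw⟩, c ⟨0, hw⟩) z, ?_⟩
  change ∑ j : Fin w, Pi.single (M := fun _ => ZMod D) (⟨0, hw⟩, c ⟨0, hw⟩) z (j, c j) = z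
  rw [sum_eq_single ⟨0, hw⟩]
  · simp
  · intro j _ hj
    rw [Pi.single_eq_of_ne]
    simp [hj]
  · simp

/-- `wordSum c` is a surjective homomorphism, so its fibres all have the same size. -/
theorem card_wordSum_val_lt {w q D : ℕ} [NeZero D] (hw : 0 < w) (c : Fin w → Fin q) {r : ℕ}
    (hr : r ≤ D) :
    D * #{x : Fin w × Fin q → ZMod D | (wordSum c x).val < r} = r * D ^ (w * q) := by
  classical
  have hfib : ∀ z z' : ZMod D, #{x : Fin w × Fin q → ZMod D | wordSum c x = z} =
      #{x : Fin w × Fin q → ZMod D | wordSum c x = z'} := fun z z' =>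
    AddMonoidHom.card_fiber_eq_of_mem_range (wordSum c) (wordSum_surjective hw c z)
      (wordSum_surjective hw c z')
  have hall : D ^ (w * q) = D * #{x | wordSum (D := D) c x = 0} := by
    calc D ^ (w * q) = #(univ : Finset (Fin w × Fin q → ZMod D)) := by
          simp [ZMod.card]
      _ = ∑ z : ZMod D, #{x : Fin w × Fin q → ZMod D | wordSum c x = z} :=
          card_eq_sum_card_fiberwise (f := wordSum c) (t := univ)
            fun _ _ => mem_coe.2 (mem_univ _)
      _ = ∑ z : ZMod D, #{x | wordSum (D := D) c x = 0} := sum_congr rfl fun z _ => hfib z 0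
      _ = _ := by rw [sum_const, card_univ, ZMod.card, smul_eq_mul]
  have hZ : #{z : ZMod D | z.val < r} = r := by
    rw [← card_range r]
    refine card_bij (fun z _ => z.val) (fun z hz => ?_) (fun z _ z' _ h => ZMod.val_injective D h)
      fun i hi => ⟨(i : ZMod D), ?_, ?_⟩
    · simpa using hz
    all_goals
      have : i < D := (mem_range.1 hi).trans_le hr
      simp [ZMod.val_cast_of_lt this, mem_range.1 hi]
  have hpart : #{x : Fin w × Fin q → ZMod D | (wordSum c x).val < r} =
      r * #{x | wordSum (D := D) c x = 0} := by
    rw [card_eq_sum_card_fiberwise (f := wordSum c) (t := {z : ZMod D | z.val < r})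
      (fun x hx => by simpa using hx)]
    rw [sum_congr rfl (g := fun _ => #{x | wordSum (D := D) c x = 0}), sum_const, hZ, smul_eq_mul]
    intro z hz
    rw [← hfib z 0, filter_filter]
    congr 1
    ext x
    simp only [mem_filter, mem_univ, true_and]
    refine ⟨fun h => h.2, fun h => ⟨?_, h⟩⟩
    rw [h]; simpa using hz
  rw [hpart, hall]; ring

/-- The induced matchings defined by a code: translation by the indicator vector of a word. -/
def codeMatchings {w q t : ℕ} [NeZero (2 * w)] (ht : t ≤ w) (Q : Finset (Fin w → Fin q))
    (hQ : ∀ c ∈ Q, ∀ c' ∈ Q, c ≠ c' → agreement c c' ≤ t) :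
    InducedMatchings Q (Fin w × Fin q → ZMod (2 * w)) where
  -- Translation by `c` adds `w` to `wordSum c`, and translation by another word adds at most `t`.
  -- From the window `[0, w - t)` the first leads into `[w, 2 * w - t)` and the second into `[0,
  -- w)`. These are disjoint, and nothing wraps around modulo `2 * w`.
  part c := {x | (wordSum c.1 x).val < w - t}
  shift c := Equiv.addRight (wordVec c.1)
  induced := by
    have hw : 2 * w ≠ 0 := NeZero.ne _
    rintro c c' x z hx hz - h
    by_contra hne
    have hne' : c'.1 ≠ c.1 := fun h => hne (Subtype.ext h)
    have hle := hQ c'.1 c'.2 c.1 c.2 hne'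
    simp only [mem_filter, mem_univ, true_and] at hx hz
    have h1 := congrArg (wordSum c.1) h
    simp only [Equiv.coe_addRight, map_add, wordSum_wordVec, agreement_self] at h1
    have h2 : ((((wordSum c.1 x).val + agreement c'.1 c.1 : ℕ)) : ZMod (2 * w)) =
        (((wordSum c.1 z).val + w : ℕ) : ZMod (2 * w)) := by
      push_cast
      rw [ZMod.natCast_zmod_val, ZMod.natCast_zmod_val]
      exact h1
    have h3 := congrArg ZMod.val h2
    rw [ZMod.val_cast_of_lt (by omega), ZMod.val_cast_of_lt (by omega)] at h3
    omega

/-! ### Choice of parameters. -/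

theorem exists_maximal_size {q L : ℕ} (hq : 0 < q) (hL : 0 < L) (W : ℕ) :
    ∀ n, 4 * L * (2 * W) ^ (W * q) + W ≤ n → ∃ w, W ≤ w ∧ 4 * L * (2 * w) ^ (w * q) ≤ n ∧
      n < 4 * L * (2 * (w + 1)) ^ ((w + 1) * q) := by
  intro n hn
  let p : ℕ → Prop := fun w => 4 * L * (2 * w) ^ (w * q) ≤ n
  have hW : p W := by change _ ≤ n; omega
  have hWn : W ≤ n := by omega
  refine ⟨Nat.findGreatest p n, Nat.le_findGreatest hWn hW, Nat.findGreatest_spec hWn hW, ?_⟩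
  by_contra! h
  set w := Nat.findGreatest p n
  by_cases hw : w + 1 ≤ n
  · exact Nat.findGreatest_is_greatest (Nat.lt_succ_self w) hw h
  · have h1 : 2 * (w + 1) ≤ (2 * (w + 1)) ^ ((w + 1) * q) :=
      Nat.le_self_pow (by positivity) _
    have h2 : (2 * (w + 1)) ^ ((w + 1) * q) ≤ 4 * L * (2 * (w + 1)) ^ ((w + 1) * q) :=
      Nat.le_mul_of_pos_left _ (by positivity)
    omega

/-- Since `lg n ≤ 6 * w * q * lg w` and `lg lg n ≥ lg w`, the constant `1 / (12 * q)` makes the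
factor beyond `n` at most `2 ^ (w / 2)`. -/
theorem rpow_exponent_le {q L w n : ℕ} (hq : 0 < q) (hL : 0 < L) (hw : 4 ≤ w) (hLw : 4 * L ≤ w)
    (h1 : 4 * L * (2 * w) ^ (w * q) ≤ n) (h2 : n < 4 * L * (2 * (w + 1)) ^ ((w + 1) * q)) :
    1 ≤ (n : ℝ) ^ (1 + 1 / (12 * q : ℝ) / Real.logb 2 (Real.logb 2 (n : ℝ))) ∧
    (n : ℝ) ^ (1 + 1 / (12 * q : ℝ) / Real.logb 2 (Real.logb 2 (n : ℝ))) ≤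
      n * ((2 : ℝ) ^ (1 / 2 : ℝ)) ^ w := by
  have hw' : (4 : ℝ) ≤ w := by exact_mod_cast hw
  have hq' : (1 : ℝ) ≤ q := by exact_mod_cast hq
  have hpow : 2 ^ w ≤ n := by
    calc 2 ^ w ≤ (2 * w) ^ w := Nat.pow_le_pow_left (by omega) _
      _ ≤ (2 * w) ^ (w * q) := Nat.pow_le_pow_right (by omega) (Nat.le_mul_of_pos_right _ hq)
      _ ≤ 4 * L * (2 * w) ^ (w * q) := Nat.le_mul_of_pos_left _ (by positivity)
      _ ≤ n := h1
  have hn1 : 1 ≤ n := Nat.one_le_two_pow.trans hpow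
  have hn0 : (0 : ℝ) < n := by exact_mod_cast hn1
  have hlgw : 0 < Real.logb 2 w := Real.logb_pos (by norm_num) (by linarith)
  have hlg : (w : ℝ) ≤ Real.logb 2 n := by
    rw [Real.le_logb_iff_rpow_le (by norm_num) hn0, Real.rpow_natCast]
    exact_mod_cast hpow
  have hlglg : Real.logb 2 w ≤ Real.logb 2 (Real.logb 2 n) :=
    Real.logb_le_logb_of_le (by norm_num) (by linarith) hlg
  have hup : n ≤ (w * w) ^ (3 * (w * q)) := by
    calc n ≤ 4 * L * (2 * (w + 1)) ^ ((w + 1) * q) := h2.le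
      _ ≤ (w * w) * (w * w) ^ ((w + 1) * q) :=
          Nat.mul_le_mul (by nlinarith) (Nat.pow_le_pow_left (by nlinarith) _)
      _ = (w * w) ^ ((w + 1) * q + 1) := by rw [pow_succ]; ring
      _ ≤ _ := Nat.pow_le_pow_right (by nlinarith) (by nlinarith)
  have hlgup : Real.logb 2 n ≤ 6 * w * q * Real.logb 2 w := by
    have : Real.logb 2 n ≤ Real.logb 2 (((w : ℝ) * w) ^ (3 * (w * q))) :=
      Real.logb_le_logb_of_le (by norm_num) hn0 (by exact_mod_cast hup)
    rw [Real.logb_pow, Real.logb_mul (by linarith) (by linarith)] at this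
    push_cast at this
    linarith
  set l := Real.logb 2 (Real.logb 2 (n : ℝ)) with hl
  have hl0 : 0 < l := hlgw.trans_le hlglg
  constructor
  · exact Real.one_le_rpow (by exact_mod_cast hn1) (by positivity)
  · rw [Real.rpow_add hn0, Real.rpow_one]
    refine mul_le_mul_of_nonneg_left ?_ hn0.le
    rw [← Real.rpow_mul_natCast (by norm_num)]
    calc (n : ℝ) ^ (1 / (12 * q : ℝ) / l) = (2 : ℝ) ^ (Real.logb 2 n * (1 / (12 * q : ℝ) / l)) := by
          rw [Real.rpow_mul (by norm_num), Real.rpow_logb (by norm_num) (by norm_num) hn0]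
      _ ≤ (2 : ℝ) ^ ((1 / 2 : ℝ) * w) := by
          refine Real.rpow_le_rpow_of_exponent_le (by norm_num) ?_
          rw [div_div, mul_one_div, div_le_iff₀ (by positivity)]
          have : 6 * (w : ℝ) * q * Real.logb 2 w ≤ 6 * w * q * l := by gcongr
          linarith

/-- Passing from `w` to `w + 1` costs only a factor polynomial in `w`, because `(1 + 1 / w) ^ w ≤
3`. Hence padding to an arbitrary `n` is harmless. -/
theorem succ_pow_le {q w : ℕ} (hw : 0 < w) :
    ((2 * (w + 1) : ℕ) : ℝ) ^ ((w + 1) * q) ≤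
      (12 : ℝ) ^ q * (w : ℝ) ^ q * ((2 * w : ℕ) : ℝ) ^ (w * q) := by
  have hw' : (1 : ℝ) ≤ w := by exact_mod_cast hw
  have h3 : (1 + 1 / (w : ℝ)) ^ w ≤ 3 := by
    calc (1 + 1 / (w : ℝ)) ^ w ≤ (Real.exp (1 / w)) ^ w := by
          gcongr
          rw [add_comm]; exact Real.add_one_le_exp _
      _ = Real.exp 1 := by rw [← Real.exp_nat_mul]; congr 1; field_simp
      _ ≤ 3 := Real.exp_one_lt_three.le
  have hbase : ((2 * (w + 1) : ℕ) : ℝ) = (2 * w : ℕ) * (1 + 1 / (w : ℝ)) := by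
    push_cast; field_simp
  have hsmall : ((2 * (w + 1) : ℕ) : ℝ) ≤ 4 * w := by push_cast; linarith
  calc ((2 * (w + 1) : ℕ) : ℝ) ^ ((w + 1) * q)
      = (((2 * (w + 1) : ℕ) : ℝ) ^ w) ^ q * ((2 * (w + 1) : ℕ) : ℝ) ^ q := by
        rw [← pow_mul, ← pow_add]; congr 1; ring
    _ ≤ (((2 * w : ℕ) : ℝ) ^ w * 3) ^ q * (4 * w) ^ q := by
        gcongr
        rw [hbase, mul_pow]
        gcongr
    _ = (12 : ℝ) ^ q * (w : ℝ) ^ q * ((2 * w : ℕ) : ℝ) ^ (w * q) := by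
        rw [mul_pow, mul_pow, ← pow_mul, show (12 : ℝ) = 3 * 4 by norm_num, mul_pow]; ring

/-- The parameters of the construction for a given number of vertices. -/
theorem exists_parameters {q L : ℕ} (hq : 0 < q) (hL : 0 < L) (M : ℝ) (hM : 0 < M) :
    ∃ N : ℕ, ∀ n, N ≤ n → ∃ w, 4 ≤ w ∧ 4 * L * (2 * w) ^ (w * q) ≤ n ∧
      1 ≤ (n : ℝ) ^ (1 + 1 / (12 * q : ℝ) / Real.logb 2 (Real.logb 2 (n : ℝ))) ∧
      M * (n : ℝ) ^ (1 + 1 / (12 * q : ℝ) / Real.logb 2 (Real.logb 2 (n : ℝ))) <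
        2 ^ w * ((2 * w : ℕ) : ℝ) ^ (w * q) := by
  -- Of the `2 ^ w = r ^ w * r ^ w` matchings, one factor `r ^ w` pays for the communication
  -- exponent and the other beats the polynomial loss from padding.
  set r : ℝ := (2 : ℝ) ^ (1 / 2 : ℝ) with hr
  have hr1 : 1 < r := Real.one_lt_rpow (by norm_num) (by norm_num)
  have hrr : r * r = 2 := by rw [hr, ← Real.rpow_add (by norm_num)]; norm_num
  set A : ℝ := M * (4 * L) * 12 ^ q with hA
  have hA0 : 0 < A := by
    have : (0 : ℝ) < L := by exact_mod_cast hL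
    positivity
  have hev := (tendsto_pow_const_div_const_pow_of_one_lt q hr1).eventually_lt_const
    (show 0 < 1 / A by positivity)
  obtain ⟨W, hW⟩ := Filter.eventually_atTop.1 hev
  set W' := max W (4 * L)
  refine ⟨4 * L * (2 * W') ^ (W' * q) + W', fun n hn => ?_⟩
  obtain ⟨w, hww, h1, h2⟩ := exists_maximal_size hq hL W' n hn
  have hLw : 4 * L ≤ w := (le_max_right _ _).trans hww
  have hw4 : 4 ≤ w := by omega
  obtain ⟨h3, h4⟩ := rpow_exponent_le hq hL hw4 hLw h1 h2
  refine ⟨w, hw4, h1, h3, ?_⟩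
  have hpoly := hW w ((le_max_left _ _).trans hww)
  rw [div_lt_div_iff₀ (by positivity) hA0, one_mul] at hpoly
  have h5 : (n : ℝ) ≤ 4 * L * ((2 * (w + 1) : ℕ) : ℝ) ^ ((w + 1) * q) := by exact_mod_cast h2.le
  have hh : (0 : ℝ) < ((2 * w : ℕ) : ℝ) ^ (w * q) := by
    have : 0 < 2 * w := by omega
    have : (0 : ℝ) < ((2 * w : ℕ) : ℝ) := by exact_mod_cast this
    positivity
  calc M * (n : ℝ) ^ (1 + 1 / (12 * q : ℝ) / Real.logb 2 (Real.logb 2 (n : ℝ)))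
      ≤ M * ((4 * L * ((12 : ℝ) ^ q * (w : ℝ) ^ q * ((2 * w : ℕ) : ℝ) ^ (w * q))) * r ^ w) := by
        refine mul_le_mul_of_nonneg_left (h4.trans ?_) hM.le
        gcongr
        exact h5.trans (by gcongr; exact succ_pow_le (by omega))
    _ = ((w : ℝ) ^ q * A) * (r ^ w * ((2 * w : ℕ) : ℝ) ^ (w * q)) := by rw [hA]; ring
    _ < r ^ w * (r ^ w * ((2 * w : ℕ) : ℝ) ^ (w * q)) :=
        mul_lt_mul_of_pos_right hpoly (by positivity)
    _ = 2 ^ w * ((2 * w : ℕ) : ℝ) ^ (w * q) := by rw [← mul_assoc, ← mul_pow, hrr]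

theorem three_pow_mul_lt_one {L S T : ℕ} (hL : 0 < L) (h : 2 * (L : ℝ) * S < T) :
    (3 : ℝ) ^ S * (1 - 1 / (L : ℝ)) ^ T < 1 := by
  have hL1 : (1 : ℝ) ≤ L := by exact_mod_cast hL
  have h3 : (3 : ℝ) ≤ Real.exp 2 := by linarith [Real.add_one_le_exp (2 : ℝ)]
  have h0 : 0 ≤ 1 - 1 / (L : ℝ) := by
    rw [sub_nonneg, div_le_one (by linarith)]; exact hL1
  calc (3 : ℝ) ^ S * (1 - 1 / (L : ℝ)) ^ T
      ≤ Real.exp 2 ^ S * Real.exp (-(1 / (L : ℝ))) ^ T := by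
        gcongr
        exact Real.one_sub_le_exp_neg _
    _ = Real.exp (S * 2 + T * (-(1 / (L : ℝ)))) := by
        rw [← Real.exp_nat_mul, ← Real.exp_nat_mul, ← Real.exp_add]
    _ < 1 := by
        rw [Real.exp_lt_one_iff]
        have : (S : ℝ) * 2 < T / L := by rw [lt_div_iff₀ (by linarith)]; linarith
        have h' : (T : ℝ) * (-(1 / (L : ℝ))) = -(T / L) := by ring
        rw [h']; linarith

/-! ### Assembly. -/

theorem two_mul_card_codeMatchings_part {w q t : ℕ} [NeZero (2 * w)] (ht : t ≤ w)
    (Q : Finset (Fin w → Fin q)) (hQ : ∀ c ∈ Q, ∀ c' ∈ Q, c ≠ c' → agreement c c' ≤ t) (c : Q) :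
    2 * w * #((codeMatchings ht Q hQ).part c) = (w - t) * (2 * w) ^ (w * q) :=
  card_wordSum_val_lt (Nat.pos_of_ne_zero fun h => NeZero.ne (2 * w) (by simp [h])) c.1 (by omega)

theorem OneWayProtocol.mul_le_expectedSize {n : ℕ} (P : OneWayProtocol n)
    (GA GB : SimpleGraph (Fin n)) {δ v : ℝ} (hv : 0 ≤ v)
    (h : ENNReal.ofReal (1 - δ) ≤ (P.output GA GB).toOuterMeasure {C | v ≤ (C.card : ℝ)}) :
    (1 - δ) * v ≤ P.expectedSize GA GB := by
  classical
  have hne : ∀ C, P.output GA GB C ≠ ⊤ := fun C => (P.output GA GB).apply_ne_top C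
  rw [PMF.toOuterMeasure_apply_fintype] at h
  have hfin : ∑ C, ({C | v ≤ (C.card : ℝ)} : Set (Finset (Fin n))).indicator (P.output GA GB) C
      ≠ ⊤ := by
    refine ENNReal.sum_ne_top.2 fun C _ => ?_
    rw [Set.indicator_apply]
    split_ifs
    · exact hne C
    · exact ENNReal.zero_ne_top
  have h1 := (ENNReal.ofReal_le_iff_le_toReal hfin).1 h
  rw [ENNReal.toReal_sum fun C hC => ne_of_lt ((ENNReal.sum_lt_top.1 (lt_top_iff_ne_top.2 hfin)) C hC)]
    at h1
  refine (mul_le_mul_of_nonneg_right h1 hv).trans ?_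
  rw [sum_mul, expectedSize]
  refine sum_le_sum fun C _ => ?_
  rw [Set.indicator_apply]
  split_ifs with hC
  · exact mul_le_mul_of_nonneg_left hC ENNReal.toReal_nonneg
  · simpa using mul_nonneg ENNReal.toReal_nonneg (Nat.cast_nonneg _)

theorem InducedMatchings.minVertexCoverSize_pos {K X : Type*} [Fintype X]
    (D : InducedMatchings K X) {L n : ℕ} (hL : 0 < L) (e : Vertex X L ↪ Fin n) (f : K × X → Fin L)
    (c : K) (hc : #(D.part c) < Fintype.card X) :
    0 < minVertexCoverSize (D.aliceGraph e f ⊔ D.bobGraph e c) := by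
  classical
  obtain ⟨C, hC, hcard⟩ := exists_isVertexCover_card_eq (D.aliceGraph e f ⊔ D.bobGraph e c)
  rw [← hcard]
  obtain ⟨x, -, hx⟩ := exists_mem_notMem_of_card_lt_card (t := univ) (by simpa using hc)
  have hadj : (D.aliceGraph e f ⊔ D.bobGraph e c).Adj (e (false, false, x, ⟨0, hL⟩))
      (e (false, true, x, ⟨0, hL⟩)) :=
    Or.inr (D.adj_of_bobRel e ⟨x, ⟨0, hL⟩, hx, Or.inl ⟨rfl, rfl⟩⟩)
  have : 0 < #C := by
    rcases hC hadj with h | h <;> exact card_pos.2 ⟨_, by simpa using h⟩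
  exact_mod_cast this

theorem mainTheorem3 (ε : ℝ) (hε : 0 < ε) :
    ∃ c : ℝ, 0 < c ∧ ∀ δ : ℝ, 0 < δ → ∃ N : ℕ, ∀ n : ℕ, N ≤ n →
      ∀ P : OneWayProtocol n,
        P.CommunicationAtMost ((n : ℝ) ^ (1 + c / Real.logb 2 (Real.logb 2 (n : ℝ)))) →
        P.OutputsVertexCover →
        ∃ GA GB : SimpleGraph (Fin n),
          OneWayProtocol.IsBipartiteInput GA GB ∧
          0 < minVertexCoverSize (GA ⊔ GB) ∧
          (3 / 2 - ε) * minVertexCoverSize (GA ⊔ GB) ≤ P.expectedSize GA GB ∧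
          ENNReal.ofReal (1 - δ) ≤
            (P.output GA GB).toOuterMeasure
              {C | (3 / 2 - ε) * minVertexCoverSize (GA ⊔ GB) ≤ (C.card : ℝ)} := by
  classical
  set η := min ε 1 with hη
  have hη0 : 0 < η := lt_min hε one_pos
  have hη1 : η ≤ 1 := min_le_right _ _
  have hηε : η ≤ ε := min_le_left _ _
  -- The same `a` is the number of copies `L`, fixes the alphabet `4 ^ a`, and gives the agreement
  -- bound `w / a`. The condition `9 ≤ a * η` is what absorbs the lower-order terms in `hratio`.
  obtain ⟨a, ha⟩ := exists_nat_ge (9 / η)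
  rw [div_le_iff₀ hη0] at ha
  have ha2' : (2 : ℝ) ≤ a := by nlinarith
  have ha2 : 2 ≤ a := by exact_mod_cast ha2'
  have ha0 : 0 < a := by omega
  have hq : 0 < 4 ^ a := by positivity
  refine ⟨1 / (12 * ((4 ^ a : ℕ) : ℝ)), by positivity, fun δ hδ => ?_⟩
  set δ' := min δ (η / 3) with hδ'
  have hδ0 : 0 < δ' := lt_min hδ (by positivity)
  obtain ⟨N, hN⟩ := exists_parameters hq ha0 (3 * a * 4 / (δ' * η)) (by positivity)
  refine ⟨N, fun n hn P hcomm hP => ?_⟩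
  obtain ⟨w, hw4, hfit, hs1, hs⟩ := hN n hn
  set s := (n : ℝ) ^ (1 + 1 / (12 * ((4 ^ a : ℕ) : ℝ)) / Real.logb 2 (Real.logb 2 (n : ℝ)))
    with hsdef
  have : NeZero (2 * w) := ⟨by omega⟩
  set t := w / a with ht
  have htw : t < w := Nat.div_lt_self (by omega) (by omega)
  have hat : a * t ≤ w := Nat.mul_div_le w a
  obtain ⟨Q, hQcard, hQ⟩ := exists_code (w := w) (a := a) (t := t)
    (Nat.lt_mul_div_succ w ha0).le htw
  have : Nonempty Q := by
    obtain ⟨c, hc⟩ := card_pos.1 ((show 0 < 2 ^ w by positivity).trans_le hQcard)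
    exact ⟨⟨c, hc⟩⟩
  let D := codeMatchings htw.le Q hQ
  set h := (2 * w) ^ (w * 4 ^ a) with hh
  have hh0 : 0 < h := by positivity
  have hX : Fintype.card (Fin w × Fin (4 ^ a) → ZMod (2 * w)) = h := by
    rw [Fintype.card_fun, ZMod.card, Fintype.card_prod, Fintype.card_fin, Fintype.card_fin]
  have hρ := two_mul_card_codeMatchings_part htw.le Q hQ
  obtain ⟨e⟩ : Nonempty
      (InducedMatchings.Vertex (Fin w × Fin (4 ^ a) → ZMod (2 * w)) a ↪ Fin n) := by
    refine Function.Embedding.nonempty_of_card_le ?_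
    rw [Fintype.card_prod, Fintype.card_prod, Fintype.card_prod, hX, Fintype.card_bool,
      Fintype.card_fin, Fintype.card_fin]
    linarith
  have hh0' : (0 : ℝ) < h := by exact_mod_cast hh0
  have hS : ∀ G, ∀ m ∈ (P.alice G).support, m.length ≤ ⌊s⌋₊ := fun G m hm =>
    Nat.le_floor (hcomm G m hm)
  -- The factor `3 * a` in place of `2 * a` leaves room for the floor on the right, since `a * s ≥
  -- 1`.
  have hT : 2 * (a : ℝ) * ⌊s⌋₊ < ⌊δ' * Fintype.card Q * (η / 4 * h)⌋₊ := by
    have h1 : (⌊s⌋₊ : ℝ) ≤ s := Nat.floor_le (by linarith)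
    have h2 := Nat.sub_one_lt_floor (δ' * Fintype.card Q * (η / 4 * h))
    have h3 : (2 : ℝ) ^ w ≤ Fintype.card Q := by
      rw [Fintype.card_coe]; exact_mod_cast hQcard
    have h4 : 3 * a * s < δ' * Fintype.card Q * (η / 4 * h) := by
      calc 3 * a * s = δ' * (η / 4) * (3 * a * 4 / (δ' * η) * s) := by field_simp
        _ < δ' * (η / 4) * (2 ^ w * ((2 * w : ℕ) : ℝ) ^ (w * 4 ^ a)) :=
            mul_lt_mul_of_pos_left hs (by positivity)
        _ = δ' * 2 ^ w * (η / 4 * h) := by rw [hh]; push_cast; ring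
        _ ≤ _ := by gcongr
    nlinarith
  obtain ⟨f, c, hfc⟩ := D.exists_hard_input ha0 e P _ _ hS hP (three_pow_mul_lt_one ha0 hT)
    δ' (η / 4 * h) (by positivity) (Nat.floor_le (by positivity))
  have hρc : 2 * (w : ℝ) * #(D.part c) = (w - t) * h := by
    have := hρ c
    have h' : ((2 * w * #(D.part c) : ℕ) : ℝ) = (((w - t) * h : ℕ) : ℝ) := by exact_mod_cast this
    push_cast [Nat.cast_sub htw.le] at h'
    exact h'
  have hw0 : (0 : ℝ) < w := by exact_mod_cast (by omega : 0 < w)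
  have hρ_le : (#(D.part c) : ℝ) ≤ h / 2 := by
    have : (w - t : ℝ) * h ≤ w * h := by gcongr; simp
    nlinarith
  have hρ_ge : (1 - 1 / (a : ℝ)) * h / 2 ≤ #(D.part c) := by
    have h1 : (t : ℝ) ≤ w * (1 / a) := by
      rw [mul_one_div, le_div_iff₀ (by linarith)]
      have : ((a * t : ℕ) : ℝ) ≤ w := by exact_mod_cast hat
      push_cast at this; linarith
    have h2 : (w * (1 - 1 / (a : ℝ))) * h ≤ (w - t) * h := by
      gcongr; linarith
    refine le_of_mul_le_mul_left ?_ (show 0 < 2 * (w : ℝ) by positivity)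
    rw [hρc]; linarith
  have hmvc := D.minVertexCoverSize_sup_le e f c
  have hpos := D.minVertexCoverSize_pos ha0 e f c (by
    rw [hX]
    have : (#(D.part c) : ℝ) < h := by linarith
    exact_mod_cast this)
  rw [hX] at hmvc hfc
  set mvc := minVertexCoverSize (D.aliceGraph e f ⊔ D.bobGraph e c) with hmvcdef
  -- The excess over `a * h` is at most `h` from the density falling short of `1 / 2` by `1 / (2 *
  -- a)`, and `h / 2` from the edges of the matching `c`.
  have hmvc' : mvc ≤ a * h + 3 / 2 * h := by
    have h1 : 2 * (a : ℝ) * ((h : ℝ) - #(D.part c)) ≤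
        2 * a * ((h : ℝ) - (1 - 1 / (a : ℝ)) * h / 2) := by gcongr
    have h2 : 2 * (a : ℝ) * ((h : ℝ) - (1 - 1 / (a : ℝ)) * h / 2) = a * h + h := by
      field_simp; ring
    linarith
  have hratio : (3 / 2 - η / 2) * mvc ≤ a * (2 * h - #(D.part c)) - a * (η / 4 * h) := by
    have h1 : (3 / 2 - η / 2) * mvc ≤ (3 / 2 - η / 2) * (a * h + 3 / 2 * h) :=
      mul_le_mul_of_nonneg_left hmvc' (by linarith)
    have h2 : (a : ℝ) * (2 * h - h / 2) ≤ a * (2 * h - #(D.part c)) := by gcongr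
    have h3 : (9 : ℝ) * h ≤ a * η * h := by gcongr
    nlinarith
  have hprob : ENNReal.ofReal (1 - δ') ≤
      (P.output (D.aliceGraph e f) (D.bobGraph e c)).toOuterMeasure
        {C | (3 / 2 - η / 2) * mvc ≤ (C.card : ℝ)} := by
    refine hfc.trans (MeasureTheory.measure_mono fun C hC => ?_)
    rw [Set.mem_ofPred_eq] at hC ⊢
    linarith
  refine ⟨D.aliceGraph e f, D.bobGraph e c, D.isBipartiteInput e f c, hpos, ?_, ?_⟩
  -- With `δ' ≤ η / 3`, the factor `1 - δ'` costs at most another `η / 2` of the ratio.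
  · refine le_trans ?_ (P.mul_le_expectedSize _ _ (mul_nonneg (by linarith) hpos.le) hprob)
    rw [← mul_assoc]
    refine mul_le_mul_of_nonneg_right ?_ hpos.le
    have : δ' ≤ η / 3 := min_le_right _ _
    nlinarith
  · refine (ENNReal.ofReal_le_ofReal (by linarith [min_le_left δ (η / 3)])).trans
      (hprob.trans (MeasureTheory.measure_mono fun C hC => ?_))
    rw [Set.mem_ofPred_eq] at hC ⊢
    refine le_trans (mul_le_mul_of_nonneg_right ?_ hpos.le) hC
    linarith
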